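/- For $p\in[1,\infty)$ and $n\in\mathbb{N}$ let $\mathcal{K}_p^{n+1}=\{(x_0,\bar x)\in\mathbb{R}\times\mathbb{R}^n : x_0\ge\|\bar x\|_p\}$, where $\|\bar x\|_p=(|\bar x_1|^p+\cdots+|\bar x_n|^p)^{1/p}$. Call a closed convex cone $\mathcal{K}\subseteq\mathbb{R}^{n+1}$ self-dual if there is some inner product $\langle\cdot,\cdot\rangle$ on $\mathbb{R}^{n+1}$ such that $\mathcal{K}=\{y : \langle x,y\rangle\ge 0\ \text{for all } x\in\mathcal{K}\}$, and homogeneous if for all $x,y$ in the relative interior of $\mathcal{K}$ there is a linear map $A$ with $Ax=y$ and $A\mathcal{K}=\mathcal{K}$. Let $p\in(1,\infty)$ and $n\ge 2$. Then: (i) If $p<\hat p<\infty$, there is no real $(n+1)\times(n+1)$ matrix $A$ such that $A\mathcal{K}_p^{n+1}=\mathcal{K}_{\hat p}^{n+1}$. (ii) If $p\ne 2$ and $A$ is a real $(n+1)\times(n+1)$ matrix with $A\mathcal{K}_p^{n+1}=\mathcal{K}_p^{n+1}$, then $A\mathcal{K}_1^{n+1}=\mathcal{K}_1^{n+1}$;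 in particular, $$A=\alpha\begin{bmatrix}1&0\\0&D\end{bmatrix}$$ for some $\alpha>0$ and some generalized permutation matrix $D\in\mathbb{R}^{n\times n}$ (a permutation matrix in which each entry $1$ may be replaced by $-1$). (iii) If $p\ne 2$, then $\mathcal{K}_p^{n+1}$ is neither self-dual (under any inner product on $\mathbb{R}^{n+1}$) nor homogeneous. -/

import Mathlib

/-- The `p`-norm `(|x₁|ᵖ + ⋯ + |xₙ|ᵖ)^(1/p)` of a vector of `ℝⁿ`. -/
noncomputable def pNorm (p : ℝ) {n : ℕ} (x : Fin n → ℝ) : ℝ :=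
  (∑ i, |x i| ^ p) ^ (1 / p)

/-- The `p`-cone `{(x₀, x̄) ∈ ℝⁿ⁺¹ | x₀ ≥ ‖x̄‖ₚ}`. -/
def pCone (p : ℝ) (n : ℕ) : Set (Fin (n + 1) → ℝ) :=
  {x | pNorm p (Fin.tail x) ≤ x 0}

/-- A generalized (signed) permutation matrix: a permutation matrix in which each entry `1` may be
replaced by `-1`. -/
def IsSignedPermMatrix {n : ℕ} (D : Matrix (Fin n) (Fin n) ℝ) : Prop :=
  ∃ (σ : Equiv.Perm (Fin n)) (ε : Fin n → ℝ), (∀ i, ε i = 1 ∨ ε i = -1) ∧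
    D = Matrix.diagonal ε * σ.permMatrix ℝ

/-- The block diagonal matrix `diag(1, D)`. -/
def oneBlock {n : ℕ} (D : Matrix (Fin n) (Fin n) ℝ) : Matrix (Fin (n + 1)) (Fin (n + 1)) ℝ :=
  Matrix.of (Matrix.vecCons (Matrix.vecCons 1 0) (fun i => Matrix.vecCons 0 (D i)))

/-- The dual cone `{y | ⟨x, y⟩ ≥ 0 for all x ∈ K}` with respect to a given inner product `c`. -/
def dualConeWith {E : Type*} [AddCommGroup E] [Module ℝ E] (c : InnerProductSpace.Core ℝ E)
    (K : Set E) : Set E :=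
  {y | ∀ x ∈ K, 0 ≤ c.inner x y}

/-- `K` is self-dual: it equals its dual cone with respect to some inner product on the space. -/
def IsSelfDualCone {E : Type*} [AddCommGroup E] [Module ℝ E] (K : Set E) : Prop :=
  ∃ c : InnerProductSpace.Core ℝ E, dualConeWith c K = K

/-- `K` is homogeneous: the linear maps `A` with `A K = K` act transitively on the relative
interior of `K`. -/
def IsHomogeneousCone {E : Type*} [AddCommGroup E] [Module ℝ E] [TopologicalSpace E]
    [IsTopologicalAddGroup E] (K : Set E) : Prop :=
  ∀ x ∈ intrinsicInterior ℝ K, ∀ y ∈ intrinsicInterior ℝ K,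
    ∃ A : E →ₗ[ℝ] E, A x = y ∧ A '' K = K

/-! The proof rests on a linear invariant of boundary points: how closely a two-sided line `x + t v`
follows the cone, measured by the exponents `r` for which a correction of size `|t| ^ r` keeps it
inside. At a vertex `(1, ± eᵢ)` of the `1`-cone, the `p`-norm leaves its tangent at rate exactly
`|t| ^ p` in every tangent direction outside the ray, so the order is uniformly `p`
(`hasUniformContactOrder_oneConeVertex`).

A linear isomorphism from the `p`-cone to the `q`-cone carries this uniform order `p` to the image
`y` of the vertex. If a coordinate of the tail of `y` vanishes, moving along it has order `q`, so `p
= q`. If two are nonzero, a tangent direction in their plane has order `2`, so `p = 2`. As `n ≥ 2`,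
one of these happens; applying this to the inverse as well gives `p = q`, which is (i).

For an automorphism with `p ≠ 2`, the image of a vertex has exactly one nonzero tail coordinate, so
the `2n` vertex rays are permuted. Opposite vertices sum to twice the axis, and this forces the axis
to be preserved and all scale factors to agree. Hence the block form with a signed permutation,
which preserves every `p`-norm, including `p = 1`.

An inner product is `x ⬝ᵥ Q y` with `Q` invertible, so self-duality would make `Q` map the `p`-cone
onto its dot-product dual, the cone of the conjugate exponent; this forces `p = 2`. Homogeneity
fails because automorphisms cannot move the axis to another interior ray. -/

open Filter Topology

/-! ### Contact order as a linear invariant -/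

section Contact

variable {E : Type*} [AddCommGroup E] [Module ℝ E]

/-- The set `K` contains, near `x`, a curve `x + t v + |t|ʳ w`. -/
def HasContact (K : Set E) (r : ℝ) (x v : E) : Prop :=
  ∃ w : E, ∀ᶠ t : ℝ in 𝓝 0, x + t • v + (|t| ^ r) • w ∈ K

/-- All tangent directions of `K` at `x` which are not multiples of `x` have contact order
exactly `ρ`. -/
def HasUniformContactOrder (K : Set E) (ρ : ℝ) (x : E) : Prop :=
  (∀ r v, 1 < r → HasContact K r x v → HasContact K ρ x v) ∧
    ∀ r v, ρ < r → HasContact K r x v → v ∈ Submodule.span ℝ {x}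

theorem HasContact.image {F : Type*} [AddCommGroup F] [Module ℝ F] {K : Set E} {r : ℝ} {x v : E}
    (h : HasContact K r x v) (f : E →ₗ[ℝ] F) : HasContact (f '' K) r (f x) (f v) := by
  obtain ⟨w, hw⟩ := h
  refine ⟨f w, hw.mono fun t ht => ⟨_, ht, ?_⟩⟩
  simp

theorem HasUniformContactOrder.image {K : Set E} {ρ : ℝ} {x : E}
    (h : HasUniformContactOrder K ρ x) (e : E ≃ₗ[ℝ] E) :
    HasUniformContactOrder (e '' K) ρ (e x) := by
  have back : ∀ r v, HasContact (e '' K) r (e x) v → HasContact K r x (e.symm v) := by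
    intro r v hv
    have := hv.image e.symm.toLinearMap
    simpa [Set.image_image] using this
  refine ⟨fun r v hr hv => ?_, fun r v hr hv => ?_⟩
  · have := (h.1 r _ hr (back r v hv)).image e.toLinearMap
    simpa using this
  · obtain ⟨c, hc⟩ := Submodule.mem_span_singleton.1 (h.2 r _ hr (back r v hv))
    refine Submodule.mem_span_singleton.2 ⟨c, ?_⟩
    rw [← map_smul, hc, e.apply_symm_apply]

/-- One test direction off the ray, of exact order `s > 1`, is enough to determine the uniform
order. -/
theorem HasUniformContactOrder.eq_of_hasContact {K : Set E} {ρ s : ℝ} {x v : E}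
    (h : HasUniformContactOrder K ρ x) (hs : 1 < s) (hv : v ∉ Submodule.span ℝ {x})
    (h1 : HasContact K s x v) (h2 : ∀ r, s < r → ¬ HasContact K r x v) : ρ = s := by
  rcases lt_trichotomy ρ s with hlt | heq | hgt
  · exact absurd (h.2 s v hlt h1) hv
  · exact heq
  · exact absurd (h.1 s v hs h1) (h2 ρ hgt)

end Contact

/-! ### Basic properties of the `p`-norm -/

section PNorm

variable {n : ℕ} {p : ℝ}

theorem pNorm_nonneg (p : ℝ) (x : Fin n → ℝ) : 0 ≤ pNorm p x :=
  Real.rpow_nonneg (Finset.sum_nonneg fun _ _ => Real.rpow_nonneg (abs_nonneg _) _) _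

theorem pNorm_rpow (hp : 0 < p) (x : Fin n → ℝ) : pNorm p x ^ p = ∑ i, |x i| ^ p := by
  rw [pNorm, ← Real.rpow_mul (Finset.sum_nonneg fun _ _ => Real.rpow_nonneg (abs_nonneg _) _),
    one_div_mul_cancel hp.ne', Real.rpow_one]

theorem pNorm_add_le (hp : 1 ≤ p) (x y : Fin n → ℝ) : pNorm p (x + y) ≤ pNorm p x + pNorm p y :=
  Real.Lp_add_le Finset.univ x y hp

theorem pNorm_smul (hp : 0 < p) (c : ℝ) (x : Fin n → ℝ) : pNorm p (c • x) = |c| * pNorm p x := by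
  have h0 : 0 ≤ ∑ i, |x i| ^ p := Finset.sum_nonneg fun _ _ => Real.rpow_nonneg (abs_nonneg _) _
  simp only [pNorm, Pi.smul_apply, smul_eq_mul, abs_mul, Real.mul_rpow (abs_nonneg _) (abs_nonneg _)]
  rw [← Finset.mul_sum, Real.mul_rpow (Real.rpow_nonneg (abs_nonneg _) _) h0,
    ← Real.rpow_mul (abs_nonneg _), mul_one_div_cancel hp.ne', Real.rpow_one]

theorem pNorm_zero (hp : 0 < p) : pNorm p (0 : Fin n → ℝ) = 0 := by
  simpa using pNorm_smul hp 0 (0 : Fin n → ℝ)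

theorem abs_le_pNorm (hp : 0 < p) (x : Fin n → ℝ) (i : Fin n) : |x i| ≤ pNorm p x := by
  rw [← Real.rpow_le_rpow_iff (abs_nonneg _) (pNorm_nonneg p x) hp, pNorm_rpow hp]
  exact Finset.single_le_sum (f := fun i => |x i| ^ p)
    (fun _ _ => Real.rpow_nonneg (abs_nonneg _) _) (Finset.mem_univ i)

theorem continuous_pNorm (hp : 0 < p) : Continuous (pNorm p : (Fin n → ℝ) → ℝ) := by
  unfold pNorm
  refine Continuous.rpow_const (continuous_finsetSum _ fun i _ =>
    Continuous.rpow_const (by fun_prop) fun _ => Or.inr hp.le) fun _ => Or.inr (by positivity)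

theorem mem_pCone {x : Fin (n + 1) → ℝ} : x ∈ pCone p n ↔ pNorm p (Fin.tail x) ≤ x 0 := Iff.rfl

end PNorm

/-! ### Comparison of powers near zero -/

section Asymptotics

theorem tendsto_abs_rpow_zero {r : ℝ} (hr : 0 < r) : Tendsto (fun t : ℝ => |t| ^ r) (𝓝 0) (𝓝 0) := by
  have : Continuous fun t : ℝ => |t| ^ r := continuous_abs.rpow_const fun _ => Or.inr hr.le
  simpa [Real.zero_rpow hr.ne'] using this.tendsto 0

/-- A real power is Lipschitz near a positive number. -/
theorem exists_rpow_lipschitz {a : ℝ} (ha : 0 < a) (s : ℝ) :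
    ∃ L : ℝ, 0 ≤ L ∧ ∃ U ∈ 𝓝 a, ∀ x ∈ U, ∀ y ∈ U, |x ^ s - y ^ s| ≤ L * |x - y| := by
  have h : ContDiffAt ℝ 1 (fun x : ℝ => x ^ s) a := Real.contDiffAt_rpow_const_of_ne ha.ne'
  obtain ⟨L, U, hU, hL⟩ := h.exists_lipschitzOnWith
  refine ⟨L, L.2, U, hU, fun x hx y hy => ?_⟩
  simpa [Real.dist_eq] using hL.dist_le_mul x hx y hy

theorem not_eventually_rpow_le {c C ρ r : ℝ} (hc : 0 < c) (hr : ρ < r) :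
    ¬ ∀ᶠ t : ℝ in 𝓝 0, c * |t| ^ ρ ≤ C * |t| ^ r := by
  intro h
  have h1 : ∀ᶠ t : ℝ in 𝓝[>] 0, c ≤ C * |t| ^ (r - ρ) := by
    filter_upwards [h.filter_mono nhdsWithin_le_nhds, self_mem_nhdsWithin] with t ht ht0
    have ht1 : 0 < |t| := abs_pos.2 (ne_of_gt ht0)
    have h2 : 0 < |t| ^ ρ := Real.rpow_pos_of_pos ht1 _
    rw [Real.rpow_sub ht1, mul_div_assoc', le_div_iff₀ h2]
    exact ht
  have h2 : Tendsto (fun t : ℝ => C * |t| ^ (r - ρ)) (𝓝[>] 0) (𝓝 (C * 0)) :=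
    ((tendsto_abs_rpow_zero (sub_pos.2 hr)).const_mul C).mono_left nhdsWithin_le_nhds
  have := ge_of_tendsto h2 h1
  linarith

/-- Second order expansion of `(1 + t)^q` at `0`. -/
theorem tendsto_rpow_second_order (q : ℝ) :
    Tendsto (fun t : ℝ => ((1 + t) ^ q - 1 - q * t) / t ^ 2) (𝓝[≠] 0) (𝓝 (q * (q - 1) / 2)) := by
  have hpos : ∀ᶠ t : ℝ in 𝓝 0, (0 : ℝ) < 1 + t := by
    have : Tendsto (fun t : ℝ => 1 + t) (𝓝 0) (𝓝 (1 + 0)) :=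
      tendsto_id.const_add 1
    exact this.eventually (lt_mem_nhds (by norm_num))
  have hd : ∀ (s t : ℝ), 0 < 1 + t → HasDerivAt (fun t : ℝ => (1 + t) ^ s) (s * (1 + t) ^ (s - 1)) t := by
    intro s t ht
    have := ((hasDerivAt_id t).const_add 1).rpow_const (p := s) (Or.inl ht.ne')
    simpa using this
  refine HasDerivAt.lhopital_zero_nhdsNE (f' := fun t => q * (1 + t) ^ (q - 1) - q)
    (g' := fun t => 2 * t) ?_ ?_ ?_ ?_ ?_ ?_
  · filter_upwards [hpos.filter_mono nhdsWithin_le_nhds] with t ht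
    have := ((hd q t ht).sub_const 1).fun_sub ((hasDerivAt_id t).const_mul q)
    simpa using this
  · refine Eventually.of_forall fun t => ?_
    simpa using hasDerivAt_pow 2 t
  · filter_upwards [self_mem_nhdsWithin] with t ht
    simpa using ht
  · have : ContinuousAt (fun t : ℝ => (1 + t) ^ q - 1 - q * t) 0 :=
      (((hd q 0 (by norm_num)).sub_const 1).sub ((hasDerivAt_id (0:ℝ)).const_mul q)).continuousAt
    simpa [ContinuousAt] using this.tendsto.mono_left nhdsWithin_le_nhds
  · have : Continuous (fun t : ℝ => t ^ 2) := by fun_prop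
    simpa using (this.tendsto 0).mono_left nhdsWithin_le_nhds
  · have h := (hasDerivAt_iff_tendsto_slope.1 (hd (q - 1) 0 (by norm_num))).const_mul (q / 2)
    have e : q / 2 * ((q - 1) * (1 + 0) ^ (q - 1 - 1)) = q * (q - 1) / 2 := by simp; ring
    rw [e] at h
    refine h.congr' ?_
    filter_upwards [self_mem_nhdsWithin] with t ht
    have ht : t ≠ 0 := ht
    simp [slope_def_field]
    field_simp

end Asymptotics

/-! ### Contact with a `p`-cone as a scalar inequality -/

section ContactPCone

variable {n : ℕ} {p r : ℝ} {y v : Fin (n + 1) → ℝ}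

/-- By the triangle inequality the tail of the correction `w` can be traded for a larger correction
along the axis. -/
theorem hasContact_pCone_iff_pNorm (hp : 1 ≤ p) :
    HasContact (pCone p n) r y v ↔ ∃ C : ℝ, ∀ᶠ t : ℝ in 𝓝 0,
      pNorm p (Fin.tail y + t • Fin.tail v) ≤ y 0 + t * v 0 + C * |t| ^ r := by
  have hp0 : 0 < p := by linarith
  constructor
  · rintro ⟨w, hw⟩
    refine ⟨w 0 + pNorm p (Fin.tail w), hw.mono fun t ht => ?_⟩
    have ht' : pNorm p (Fin.tail (y + t • v + |t| ^ r • w)) ≤ y 0 + t * v 0 + |t| ^ r * w 0 := ht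
    have e : Fin.tail y + t • Fin.tail v
        = Fin.tail (y + t • v + |t| ^ r • w) + (-|t| ^ r) • Fin.tail w := by
      ext i; simp [Fin.tail]
    have h := pNorm_add_le hp (Fin.tail (y + t • v + |t| ^ r • w)) ((-|t| ^ r) • Fin.tail w)
    rw [← e, pNorm_smul hp0, abs_neg, abs_of_nonneg (Real.rpow_nonneg (abs_nonneg t) r)] at h
    linarith
  · rintro ⟨C, hC⟩
    refine ⟨Fin.cons C 0, hC.mono fun t ht => ?_⟩
    have e : Fin.tail (y + t • v + |t| ^ r • (Fin.cons C 0 : Fin (n + 1) → ℝ))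
        = Fin.tail y + t • Fin.tail v := by
      ext i; simp [Fin.tail]
    rw [mem_pCone, e]
    simpa [mul_comm C] using ht

/-- Raising to the powers `p` and `1 / p` is Lipschitz near positive numbers, so it changes an error
`O(|t| ^ r)` only by a constant. This removes the outer root from the norm. -/
theorem hasContact_pCone_iff (hp : 1 ≤ p) (hr : 0 < r) (hy : 0 < y 0) :
    HasContact (pCone p n) r y v ↔ ∃ C : ℝ, ∀ᶠ t : ℝ in 𝓝 0,
      ∑ i : Fin n, |y i.succ + t * v i.succ| ^ p ≤ (y 0 + t * v 0) ^ p + C * |t| ^ r := by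
  have hp0 : 0 < p := by linarith
  have key : ∀ t : ℝ, ∑ i : Fin n, |y i.succ + t * v i.succ| ^ p
      = pNorm p (Fin.tail y + t • Fin.tail v) ^ p := fun t => (pNorm_rpow hp0 _).symm
  have hz := tendsto_abs_rpow_zero hr
  have ha : Tendsto (fun t : ℝ => y 0 + t * v 0) (𝓝 0) (𝓝 (y 0)) := by
    have : Continuous fun t : ℝ => y 0 + t * v 0 := by fun_prop
    simpa using this.tendsto 0
  rw [hasContact_pCone_iff_pNorm hp]
  constructor
  · rintro ⟨C, hC⟩
    obtain ⟨L, -, U, hU, hL⟩ := exists_rpow_lipschitz hy p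
    have ha' : Tendsto (fun t : ℝ => y 0 + t * v 0 + C * |t| ^ r) (𝓝 0) (𝓝 (y 0)) := by
      simpa using ha.add (hz.const_mul C)
    refine ⟨L * |C|, ?_⟩
    filter_upwards [hC, ha hU, ha' hU] with t ht h1 h2
    rw [key]
    have h3 := hL _ h2 _ h1
    rw [add_sub_cancel_left, abs_mul, abs_of_nonneg (Real.rpow_nonneg (abs_nonneg t) r)] at h3
    have h4 := Real.rpow_le_rpow (pNorm_nonneg _ _) ht hp0.le
    have h5 := le_abs_self ((y 0 + t * v 0 + C * |t| ^ r) ^ p - (y 0 + t * v 0) ^ p)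
    linarith
  · rintro ⟨C, hC⟩
    obtain ⟨L, -, U, hU, hL⟩ := exists_rpow_lipschitz (Real.rpow_pos_of_pos hy p) (1 / p)
    have ha1 : Tendsto (fun t : ℝ => (y 0 + t * v 0) ^ p) (𝓝 0) (𝓝 (y 0 ^ p)) :=
      ha.rpow_const (Or.inl hy.ne')
    have ha' : Tendsto (fun t : ℝ => (y 0 + t * v 0) ^ p + C * |t| ^ r) (𝓝 0) (𝓝 (y 0 ^ p)) := by
      simpa using ha1.add (hz.const_mul C)
    refine ⟨L * |C|, ?_⟩
    filter_upwards [hC, ha1 hU, ha' hU, ha.eventually (lt_mem_nhds hy)] with t ht h1 h2 h6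
    rw [key] at ht
    have h3 := hL _ h2 _ h1
    rw [add_sub_cancel_left, abs_mul, abs_of_nonneg (Real.rpow_nonneg (abs_nonneg t) r)] at h3
    have h4 := Real.rpow_le_rpow (Real.rpow_nonneg (pNorm_nonneg _ _) _) ht
      (one_div_nonneg.2 hp0.le)
    rw [← Real.rpow_mul (pNorm_nonneg _ _), mul_one_div_cancel hp0.ne', Real.rpow_one] at h4
    rw [← Real.rpow_mul h6.le, mul_one_div_cancel hp0.ne', Real.rpow_one] at h3
    have h5 := le_abs_self (((y 0 + t * v 0) ^ p + C * |t| ^ r) ^ (1 / p) - (y 0 + t * v 0))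
    linarith

/-- A strictly interior point has contact of every order in every direction, with no correction;
uniform contact order therefore detects the boundary. -/
theorem hasContact_pCone_of_lt (hp : 0 < p) (hy : pNorm p (Fin.tail y) < y 0) :
    HasContact (pCone p n) r y v := by
  refine ⟨0, ?_⟩
  have h1 : Continuous fun t : ℝ => pNorm p (Fin.tail (y + t • v)) :=
    (continuous_pNorm hp).comp (by unfold Fin.tail; fun_prop)
  have h2 : Continuous fun t : ℝ => y 0 + t * v 0 := by fun_prop
  have h3 : ∀ᶠ t : ℝ in 𝓝 0, pNorm p (Fin.tail (y + t • v)) < y 0 + t * v 0 :=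
    (h1.tendsto 0).eventually_lt (h2.tendsto 0) (by simpa using hy)
  filter_upwards [h3] with t ht
  rw [smul_zero, add_zero]
  exact ht.le

end ContactPCone

/-! ### Quadratic growth along tangent directions -/

section Quadratic

theorem eventually_rpow_second_order {q : ℝ} (hq : 1 < q) :
    ∃ c C : ℝ, 0 < c ∧ 0 < C ∧ ∀ᶠ t : ℝ in 𝓝 0,
      c * t ^ 2 ≤ (1 + t) ^ q - 1 - q * t ∧ (1 + t) ^ q - 1 - q * t ≤ C * t ^ 2 := by
  have hc : 0 < q * (q - 1) / 2 := by nlinarith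
  refine ⟨q * (q - 1) / 2 / 2, q * (q - 1) / 2 * 2, by linarith, by linarith, ?_⟩
  have h := tendsto_rpow_second_order q
  have h1 := h.eventually (Ioo_mem_nhds (half_lt_self hc)
    (show q * (q - 1) / 2 < q * (q - 1) / 2 * 2 by linarith))
  rw [eventually_nhdsWithin_iff] at h1
  filter_upwards [h1] with t ht
  by_cases ht0 : t = 0
  · simp [ht0]
  · have h2 : 0 < t ^ 2 := by positivity
    have h3 := ht ht0
    exact ⟨((lt_div_iff₀ h2).1 h3.1).le, ((div_lt_iff₀ h2).1 h3.2).le⟩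

/-- Moving along a direction that annihilates the linear term, the sum of two scaled powers
grows quadratically. -/
theorem eventually_two_rpow_quadratic {q A B : ℝ} (hq : 1 < q) (hA : 0 < A) (hB : 0 < B) :
    ∃ c C : ℝ, 0 < c ∧ ∀ᶠ t : ℝ in 𝓝 0,
      c * t ^ 2 ≤ A * ((1 + t / A) ^ q - 1) + B * ((1 + t / (-B)) ^ q - 1) ∧
      A * ((1 + t / A) ^ q - 1) + B * ((1 + t / (-B)) ^ q - 1) ≤ C * t ^ 2 := by
  obtain ⟨c, C, hc, hC, h⟩ := eventually_rpow_second_order hq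
  have hdiv : ∀ D : ℝ, Tendsto (fun t : ℝ => t / D) (𝓝 0) (𝓝 0) := fun D => by
    have : Continuous fun t : ℝ => t / D := by fun_prop
    simpa using this.tendsto 0
  refine ⟨c / A + c / B, C / A + C / B, by positivity, ?_⟩
  filter_upwards [(hdiv A).eventually h, (hdiv (-B)).eventually h] with t h1 h2
  -- The linear terms `A q (t / A)` and `B q (t / (-B))` cancel, so they may be subtracted freely.
  have e : A * ((1 + t / A) ^ q - 1) + B * ((1 + t / (-B)) ^ q - 1)
      = A * ((1 + t / A) ^ q - 1 - q * (t / A)) + B * ((1 + t / (-B)) ^ q - 1 - q * (t / (-B))) := by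
    field_simp; ring
  have e1 : ∀ k : ℝ, (k / A + k / B) * t ^ 2 = A * (k * (t / A) ^ 2) + B * (k * (t / (-B)) ^ 2) := by
    intro k; field_simp
  rw [e, e1, e1]
  exact ⟨add_le_add (mul_le_mul_of_nonneg_left h1.1 hA.le) (mul_le_mul_of_nonneg_left h2.1 hB.le),
    add_le_add (mul_le_mul_of_nonneg_left h1.2 hA.le) (mul_le_mul_of_nonneg_left h2.2 hB.le)⟩

end Quadratic

/-! ### Contact orders at vertices and at other boundary points -/

section ContactOrder

variable {n : ℕ} {p q : ℝ} {y : Fin (n + 1) → ℝ}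

/-- The vertices `(1, ± eᵢ)` of the `1`-cone. -/
def oneConeVertex (i : Fin n) (s : ℝ) : Fin (n + 1) → ℝ := Fin.cons 1 (Pi.single i s)

@[simp] theorem oneConeVertex_zero (i : Fin n) (s : ℝ) : oneConeVertex i s 0 = 1 := rfl

@[simp] theorem oneConeVertex_succ (i j : Fin n) (s : ℝ) :
    oneConeVertex i s j.succ = (Pi.single i s : Fin n → ℝ) j := rfl

theorem hasUniformContactOrder_oneConeVertex (hp : 1 < p) (i : Fin n) {s : ℝ} (hs : |s| = 1) :
    HasUniformContactOrder (pCone p n) p (oneConeVertex i s) := by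
  have hp0 : 0 < p := by linarith
  have hss : s * s = 1 := by rw [← abs_mul_abs_self, hs, one_mul]
  -- Contact of order above `1` forces tangency. Coordinate `i` alone bounds the norm from below,
  -- and using both signs of `t` turns the one-sided estimate into an equality.
  have htan : ∀ r v, 1 < r → HasContact (pCone p n) r (oneConeVertex i s) v →
      v i.succ = s * v 0 := by
    intro r v hr h
    obtain ⟨C, hC⟩ := (hasContact_pCone_iff_pNorm hp.le).1 h
    have h1 : ∀ᶠ t : ℝ in 𝓝 0, t * (s * v i.succ - v 0) ≤ C * |t| ^ r := by
      filter_upwards [hC] with t ht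
      have h2 := abs_le_pNorm hp0 (Fin.tail (oneConeVertex i s) + t • Fin.tail v) i
      simp only [Pi.add_apply, Pi.smul_apply, Fin.tail, oneConeVertex_succ, Pi.single_eq_same,
        smul_eq_mul] at h2
      have h3 : s * (s + t * v i.succ) ≤ |s + t * v i.succ| := by
        calc _ ≤ |s * (s + t * v i.succ)| := le_abs_self _
          _ = _ := by rw [abs_mul, hs, one_mul]
      have h4 : |s + t * v i.succ| ≤ 1 + t * v 0 + C * |t| ^ r := h2.trans ht
      nlinarith
    have hneg : Tendsto (fun t : ℝ => -t) (𝓝 0) (𝓝 0) := by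
      simpa using (continuous_neg (G := ℝ)).tendsto 0
    by_contra hne
    have hd : 0 < |s * v i.succ - v 0| := by
      refine abs_pos.2 fun h0 => hne ?_
      have : s * (s * v i.succ - v 0) = 0 := by rw [h0, mul_zero]
      linear_combination this - v i.succ * hss
    refine not_eventually_rpow_le (C := C) hd hr ?_
    filter_upwards [h1, hneg.eventually h1] with t ht1 ht2
    rw [Real.rpow_one, mul_comm, ← abs_mul, abs_le]
    rw [abs_neg] at ht2
    constructor <;> linarith
  -- For tangent `v` the excess is exactly a constant times `|t| ^ p`, and the constant vanishes
  -- only if `v` is a multiple of the vertex.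
  have hsum : ∀ v : Fin (n + 1) → ℝ, v i.succ = s * v 0 → ∀ᶠ t : ℝ in 𝓝 0,
      ∑ j : Fin n, |oneConeVertex i s j.succ + t * v j.succ| ^ p
        = (oneConeVertex i s 0 + t * v 0) ^ p
          + (∑ j ∈ Finset.univ.erase i, |v j.succ| ^ p) * |t| ^ p := by
    intro v hv
    have hcont : Tendsto (fun t : ℝ => 1 + t * v 0) (𝓝 0) (𝓝 1) := by
      have : Continuous fun t : ℝ => 1 + t * v 0 := by fun_prop
      simpa using this.tendsto 0
    filter_upwards [hcont.eventually (lt_mem_nhds one_pos)] with t ht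
    rw [← Finset.add_sum_erase _ _ (Finset.mem_univ i), Finset.sum_mul]
    congr 1
    · have : oneConeVertex i s i.succ + t * v i.succ = s * (1 + t * v 0) := by
        rw [hv, oneConeVertex_succ, Pi.single_eq_same]; ring
      rw [this, abs_mul, hs, one_mul, abs_of_pos ht, oneConeVertex_zero]
    · refine Finset.sum_congr rfl fun j hj => ?_
      rw [oneConeVertex_succ, Pi.single_eq_of_ne (Finset.ne_of_mem_erase hj), zero_add, abs_mul,
        Real.mul_rpow (abs_nonneg _) (abs_nonneg _), mul_comm]
  refine ⟨fun r v hr h => ?_, fun r v hr h => ?_⟩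
  · rw [hasContact_pCone_iff hp.le hp0 one_pos]
    exact ⟨_, (hsum v (htan r v hr h)).mono fun t ht => ht.le⟩
  · have hv := htan r v (hp.trans hr) h
    obtain ⟨C, hC⟩ := (hasContact_pCone_iff hp.le (hp0.trans hr) one_pos).1 h
    have hnn : ∀ j ∈ Finset.univ.erase i, 0 ≤ |v j.succ| ^ p := fun _ _ =>
      Real.rpow_nonneg (abs_nonneg _) _
    have hT : ∑ j ∈ Finset.univ.erase i, |v j.succ| ^ p = 0 := by
      by_contra hne
      refine not_eventually_rpow_le (C := C)
        (lt_of_le_of_ne (Finset.sum_nonneg hnn) (Ne.symm hne)) hr ?_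
      filter_upwards [hC, hsum v hv] with t h1 h2
      rw [h2] at h1
      linarith
    rw [Finset.sum_eq_zero_iff_of_nonneg hnn] at hT
    refine Submodule.mem_span_singleton.2 ⟨v 0, funext fun k => ?_⟩
    refine Fin.cases (by simp) (fun j => ?_) k
    by_cases hj : j = i
    · subst hj; simp [hv, mul_comm]
    · have := hT j (Finset.mem_erase.2 ⟨hj, Finset.mem_univ _⟩)
      rw [Real.rpow_eq_zero (abs_nonneg _) hp0.ne', abs_eq_zero] at this
      simp [this, hj]

theorem notMem_span_of_zero {v : Fin (n + 1) → ℝ} (hy : y 0 ≠ 0) (hv0 : v 0 = 0) (hv : v ≠ 0) :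
    v ∉ Submodule.span ℝ {y} := by
  intro h
  obtain ⟨c, rfl⟩ := Submodule.mem_span_singleton.1 h
  have : c = 0 := by simpa [hy] using hv0
  exact hv (by simp [this])

theorem apply_zero_pos_of_mem_pCone (hp : 0 < p) (hy : y ∈ pCone p n) (hne : y ≠ 0) : 0 < y 0 := by
  have h0 : 0 ≤ y 0 := (pNorm_nonneg _ _).trans hy
  refine lt_of_le_of_ne h0 fun h => hne (funext fun k => ?_)
  refine Fin.cases h.symm (fun j => ?_) k
  have h1 := (abs_le_pNorm hp (Fin.tail y) j).trans hy
  rw [← h] at h1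
  simpa [Fin.tail] using h1

theorem HasUniformContactOrder.pNorm_eq (hq : 1 < q)
    (h : HasUniformContactOrder (pCone q n) p y)
    (hy : y ∈ pCone q n) (hy0 : 0 < y 0) (hn : 0 < n) : pNorm q (Fin.tail y) = y 0 := by
  refine le_antisymm hy (not_lt.1 fun hlt => ?_)
  refine notMem_span_of_zero hy0.ne' (v := Fin.cons 0 (Pi.single ⟨0, hn⟩ 1)) rfl (fun h0 => ?_)
    (h.2 (p + 1) _ (lt_add_one p) (hasContact_pCone_of_lt (by linarith) hlt))
  have := congrFun h0 (Fin.succ ⟨0, hn⟩)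
  rw [Fin.cons_succ, Pi.single_eq_same] at this
  exact one_ne_zero this

/-- Moving along the vanishing coordinate adds exactly `|t| ^ q` to the sum of powers, so this
direction has order `q`. -/
theorem HasUniformContactOrder.eq_of_apply_eq_zero (hq : 1 < q)
    (h : HasUniformContactOrder (pCone q n) p y)
    (hy : pNorm q (Fin.tail y) = y 0) (hy0 : 0 < y 0) {k : Fin n} (hk : y k.succ = 0) : p = q := by
  have hq0 : 0 < q := by linarith
  set v : Fin (n + 1) → ℝ := Fin.cons 0 (Pi.single k 1) with hvdef
  have hv0 : v 0 = 0 := rfl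
  have hvs : ∀ j : Fin n, v j.succ = (Pi.single k 1 : Fin n → ℝ) j := fun _ => rfl
  have hsum : ∀ t : ℝ, ∑ j : Fin n, |y j.succ + t * v j.succ| ^ q
      = (y 0 + t * v 0) ^ q + |t| ^ q := by
    intro t
    have e : y 0 ^ q = ∑ j : Fin n, |y j.succ| ^ q := by rw [← hy, pNorm_rpow hq0]; rfl
    rw [hv0, mul_zero, add_zero, e, ← Finset.add_sum_erase _ _ (Finset.mem_univ k),
      ← Finset.add_sum_erase (a := k) Finset.univ (fun j => |y j.succ| ^ q) (Finset.mem_univ k),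
      hvs, hk]
    have : ∑ j ∈ Finset.univ.erase k, |y j.succ + t * v j.succ| ^ q
        = ∑ j ∈ Finset.univ.erase k, |y j.succ| ^ q :=
      Finset.sum_congr rfl fun j hj => by simp [hvs, Finset.ne_of_mem_erase hj]
    rw [this]
    simp [Real.zero_rpow hq0.ne']
    ring
  refine h.eq_of_hasContact (v := v) hq
    (notMem_span_of_zero hy0.ne' rfl fun h0 => ?_) ?_ fun r hr hc => ?_
  · simpa [hvs] using congrFun h0 k.succ
  · exact (hasContact_pCone_iff hq.le hq0 hy0).2 ⟨1, Eventually.of_forall fun t => by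
      rw [hsum, one_mul]⟩
  · obtain ⟨C, hC⟩ := (hasContact_pCone_iff hq.le (hq0.trans hr) hy0).1 hc
    refine not_eventually_rpow_le (C := C) one_pos hr (hC.mono fun t ht => ?_)
    rw [hsum] at ht
    linarith

theorem HasUniformContactOrder.eq_two (hq : 1 < q)
    (h : HasUniformContactOrder (pCone q n) p y)
    (hy : pNorm q (Fin.tail y) = y 0) (hy0 : 0 < y 0) {a b : Fin n} (hab : a ≠ b)
    (ha : y a.succ ≠ 0) (hb : y b.succ ≠ 0) : p = 2 := by
  have hq0 : 0 < q := by linarith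
  set A : ℝ := |y a.succ| ^ q with hA
  set B : ℝ := |y b.succ| ^ q with hB
  have hA0 : 0 < A := Real.rpow_pos_of_pos (abs_pos.2 ha) _
  have hB0 : 0 < B := Real.rpow_pos_of_pos (abs_pos.2 hb) _
  -- The relative changes of coordinates `a` and `b` are `t / A` and `-t / B`; weighted by `A` and
  -- `B` they cancel to first order, leaving a positive quadratic excess.
  set v : Fin (n + 1) → ℝ :=
    Fin.cons 0 (Pi.single a (y a.succ / A) + Pi.single b (y b.succ / (-B))) with hvdef
  have hv0 : v 0 = 0 := rfl
  have hva : v a.succ = y a.succ / A := by simp [hvdef, hab]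
  have hvb : v b.succ = y b.succ / (-B) := by simp [hvdef, hab.symm]
  have hvj : ∀ j : Fin n, j ≠ a → j ≠ b → v j.succ = 0 := fun j h1 h2 => by simp [hvdef, h1, h2]
  obtain ⟨c, C, hc, hquad⟩ := eventually_two_rpow_quadratic hq hA0 hB0
  have hsum : ∀ᶠ t : ℝ in 𝓝 0, ∑ j : Fin n, |y j.succ + t * v j.succ| ^ q
      = (y 0 + t * v 0) ^ q + (A * ((1 + t / A) ^ q - 1) + B * ((1 + t / (-B)) ^ q - 1)) := by
    have hpos : ∀ D : ℝ, ∀ᶠ t : ℝ in 𝓝 0, 0 < 1 + t / D := fun D => by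
      have : Continuous fun t : ℝ => 1 + t / D := by fun_prop
      exact (this.tendsto 0).eventually (lt_mem_nhds (by simp))
    filter_upwards [hpos A, hpos (-B)] with t h1 h2
    have e : y 0 ^ q = ∑ j : Fin n, |y j.succ| ^ q := by rw [← hy, pNorm_rpow hq0]; rfl
    rw [hv0, mul_zero, add_zero, e, ← sub_eq_iff_eq_add', ← Finset.sum_sub_distrib,
      Finset.sum_eq_add_of_mem a b (Finset.mem_univ _) (Finset.mem_univ _) hab]
    · have ea : y a.succ + t * v a.succ = y a.succ * (1 + t / A) := by rw [hva]; ring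
      have eb : y b.succ + t * v b.succ = y b.succ * (1 + t / (-B)) := by rw [hvb]; ring
      rw [ea, eb, abs_mul, abs_mul, Real.mul_rpow (abs_nonneg _) (abs_nonneg _),
        Real.mul_rpow (abs_nonneg _) (abs_nonneg _), abs_of_pos h1, abs_of_pos h2, ← hA, ← hB]
      ring
    · rintro j - ⟨h1, h2⟩
      simp [hvj j h1 h2]
  have hsq : ∀ t : ℝ, |t| ^ (2 : ℝ) = t ^ 2 := fun t => by
    rw [Real.rpow_two, sq_abs]
  refine h.eq_of_hasContact (v := v) one_lt_two
    (notMem_span_of_zero hy0.ne' rfl fun h0 => ?_) ?_ fun r hr hcon => ?_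
  · have := congrFun h0 a.succ
    rw [hva, Pi.zero_apply, div_eq_zero_iff] at this
    exact this.elim ha hA0.ne'
  · refine (hasContact_pCone_iff hq.le two_pos hy0).2 ⟨C, ?_⟩
    filter_upwards [hsum, hquad] with t h1 h2
    rw [h1, hsq]
    linarith [h2.2]
  · obtain ⟨C', hC'⟩ := (hasContact_pCone_iff hq.le (by linarith) hy0).1 hcon
    refine not_eventually_rpow_le (C := C') hc hr ?_
    filter_upwards [hsum, hquad, hC'] with t h1 h2 h3
    rw [h1] at h3
    rw [hsq]
    linarith [h2.1]

end ContactOrder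

/-! ### Linear maps between cones and their action on vertices -/

section ConeMaps

variable {n : ℕ} {p q : ℝ}

/-- The first standard basis vector, the axis of the cones `pCone p n`. -/
def coneAxis (n : ℕ) : Fin (n + 1) → ℝ := Pi.single 0 1

theorem tail_coneAxis : Fin.tail (coneAxis n) = 0 := by
  ext i; simp [coneAxis, Fin.tail]

theorem coneAxis_mem_pCone (hp : 0 < p) : coneAxis n ∈ pCone p n := by
  rw [mem_pCone, tail_coneAxis, pNorm_zero hp]
  simp [coneAxis]

theorem coneAxis_ne_zero : coneAxis n ≠ 0 := by simp [coneAxis]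

theorem pNorm_single (hp : 0 < p) (i : Fin n) (s : ℝ) : pNorm p (Pi.single i s) = |s| := by
  have h : ∑ j, |(Pi.single i s : Fin n → ℝ) j| ^ p = |s| ^ p := by
    rw [Finset.sum_eq_single i]
    · simp
    · intro j _ hj; simp [hj, Real.zero_rpow hp.ne']
    · simp
  rw [pNorm, h, ← Real.rpow_mul (abs_nonneg _), mul_one_div_cancel hp.ne', Real.rpow_one]

theorem oneConeVertex_mem_pCone (hp : 0 < p) (i : Fin n) {s : ℝ} (hs : |s| = 1) :
    oneConeVertex i s ∈ pCone p n := by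
  have : Fin.tail (oneConeVertex i s) = Pi.single i s := rfl
  rw [mem_pCone, this, pNorm_single hp, hs, oneConeVertex_zero]

theorem oneConeVertex_ne_zero (i : Fin n) (s : ℝ) : oneConeVertex i s ≠ 0 := fun h => by
  simpa using congrFun h 0

/-- The cone spans the space: any vector enters it after a suitable shift along the axis, and the
axis is itself in the cone. -/
theorem surjective_of_pCone_subset_range {f : (Fin (n + 1) → ℝ) →ₗ[ℝ] (Fin (n + 1) → ℝ)} (hq : 0 < q)
    (h : pCone q n ⊆ Set.range f) : Function.Surjective f := by
  intro z
  obtain ⟨u, hu⟩ := h (coneAxis_mem_pCone hq)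
  have hz : z + (pNorm q (Fin.tail z) - z 0) • coneAxis n ∈ pCone q n := by
    have e : Fin.tail (z + (pNorm q (Fin.tail z) - z 0) • coneAxis n) = Fin.tail z := by
      ext i; simp [Fin.tail, coneAxis]
    rw [mem_pCone, e]
    simp [coneAxis]
  obtain ⟨w, hw⟩ := h hz
  exact ⟨w - (pNorm q (Fin.tail z) - z 0) • u, by rw [map_sub, map_smul, hw, hu]; abel⟩

/-- A linear map sending a `p`-cone onto a `q`-cone is invertible. -/
theorem exists_linearEquiv_of_image_pCone {f : (Fin (n + 1) → ℝ) →ₗ[ℝ] (Fin (n + 1) → ℝ)}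
    {K : Set (Fin (n + 1) → ℝ)} (hq : 0 < q) (h : f '' K = pCone q n) :
    ∃ e : (Fin (n + 1) → ℝ) ≃ₗ[ℝ] (Fin (n + 1) → ℝ), ∀ x, e x = f x := by
  have hs : Function.Surjective f :=
    surjective_of_pCone_subset_range hq (h ▸ Set.image_subset_range f K)
  exact ⟨LinearEquiv.ofBijective f ⟨LinearMap.injective_iff_surjective.2 hs, hs⟩, fun _ => rfl⟩

variable {e : (Fin (n + 1) → ℝ) ≃ₗ[ℝ] (Fin (n + 1) → ℝ)}

theorem map_vertex_spec (hp : 1 < p) (hq : 1 < q) (h : e '' pCone p n = pCone q n) (i : Fin n)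
    {s : ℝ} (hs : |s| = 1) :
    HasUniformContactOrder (pCone q n) p (e (oneConeVertex i s)) ∧ 0 < e (oneConeVertex i s) 0 ∧
      pNorm q (Fin.tail (e (oneConeVertex i s))) = e (oneConeVertex i s) 0 := by
  have h1 := (hasUniformContactOrder_oneConeVertex hp i hs).image e
  rw [h] at h1
  have hmem : e (oneConeVertex i s) ∈ pCone q n :=
    h ▸ Set.mem_image_of_mem e (oneConeVertex_mem_pCone (by linarith) i hs)
  have h2 : 0 < e (oneConeVertex i s) 0 := apply_zero_pos_of_mem_pCone (by linarith) hmem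
    ((map_ne_zero_iff e e.injective).2 (oneConeVertex_ne_zero i s))
  exact ⟨h1, h2, h1.pNorm_eq hq hmem h2 i.pos⟩

theorem eq_two_or_eq_of_image_pCone (hp : 1 < p) (hq : 1 < q) (hn : 2 ≤ n)
    (h : e '' pCone p n = pCone q n) : p = 2 ∨ p = q := by
  obtain ⟨h1, h2, h3⟩ := map_vertex_spec hp hq h ⟨0, by omega⟩ (s := 1) abs_one
  by_cases hz : ∃ k : Fin n, e (oneConeVertex ⟨0, by omega⟩ 1) k.succ = 0
  · obtain ⟨k, hk⟩ := hz
    exact Or.inr (h1.eq_of_apply_eq_zero hq h3 h2 hk)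
  · push Not at hz
    exact Or.inl (h1.eq_two hq h3 h2 (a := ⟨0, by omega⟩) (b := ⟨1, by omega⟩) (by simp)
      (hz _) (hz _))

theorem image_symm_eq {K L : Set (Fin (n + 1) → ℝ)} (h : e '' K = L) : e.symm '' L = K := by
  rw [← h, Set.image_image]; simp

/-- Cones of different exponents are not linearly isomorphic. -/
theorem eq_of_image_pCone (hp : 1 < p) (hq : 1 < q) (hn : 2 ≤ n)
    (h : e '' pCone p n = pCone q n) : p = q := by
  -- The alternative `p = 2` is settled by applying the same dichotomy to the inverse map.
  rcases eq_two_or_eq_of_image_pCone hp hq hn h with h1 | h1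
  · rcases eq_two_or_eq_of_image_pCone hq hp hn (image_symm_eq h) with h2 | h2
    · rw [h1, h2]
    · exact h2.symm
  · exact h1

/-- Two nonzero tail coordinates in the image would force `p = 2`, and none would contradict lying
on the boundary. -/
theorem exists_map_vertex_eq (hp : 1 < p) (hp2 : p ≠ 2) (h : e '' pCone p n = pCone p n)
    (i : Fin n) {s : ℝ} (hs : |s| = 1) :
    ∃ (b : ℝ) (k : Fin n) (s' : ℝ), 0 < b ∧ |s'| = 1 ∧
      e (oneConeVertex i s) = b • oneConeVertex k s' := by
  obtain ⟨h1, h2, h3⟩ := map_vertex_spec hp hp h i hs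
  have hp0 : 0 < p := by linarith
  set y := e (oneConeVertex i s)
  obtain ⟨k, hk⟩ : ∃ k : Fin n, y k.succ ≠ 0 := by
    by_contra! hall
    have : Fin.tail y = 0 := funext hall
    rw [this, pNorm_zero hp0] at h3
    exact h2.ne h3
  have hk' : ∀ j : Fin n, j ≠ k → y j.succ = 0 := fun j hj => by
    by_contra hne
    exact hp2 (h1.eq_two hp h3 h2 hj hne hk)
  have ht : Fin.tail y = Pi.single k (y k.succ) := by
    ext j
    by_cases hj : j = k
    · subst hj; simp [Fin.tail]
    · simp [Fin.tail, hj, hk' j hj]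
  rw [ht, pNorm_single hp0] at h3
  refine ⟨y 0, k, y k.succ / y 0, h2, by rw [abs_div, h3, abs_of_pos h2, div_self h2.ne'], ?_⟩
  ext j
  refine Fin.cases (by simp) (fun j => ?_) j
  by_cases hj : j = k
  · subst hj; simp [mul_div_cancel₀ _ h2.ne']
  · simp [hj, hk' j hj]

theorem eq_of_map_vertex_eq {i j k : Fin n} {s s' b b' u : ℝ} (hs : |s| = 1)
    (hb' : 0 < b') (h : e (oneConeVertex i s) = b • oneConeVertex k u)
    (h' : e (oneConeVertex j s') = b' • oneConeVertex k u) : i = j := by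
  have h1 : e (b' • oneConeVertex i s) = e (b • oneConeVertex j s') := by
    rw [map_smul, map_smul, h, h', smul_comm]
  have h2 := e.injective h1
  by_contra hij
  have h3 := congrFun h2 i.succ
  simp only [Pi.smul_apply, oneConeVertex_succ, Pi.single_eq_same, smul_eq_mul,
    Pi.single_eq_of_ne hij, mul_zero, mul_eq_zero, hb'.ne', false_or] at h3
  simp [h3] at hs

theorem vertex_add_vertex (i : Fin n) :
    oneConeVertex i 1 + oneConeVertex i (-1) = (2 : ℝ) • coneAxis n := by
  ext j
  refine Fin.cases (by simp [coneAxis]; norm_num) (fun j => ?_) j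
  by_cases hj : j = i
  · subst hj; simp [coneAxis]
  · simp [coneAxis, hj]

theorem map_coneAxis_succ_eq_zero (hp : 1 < p) (hp2 : p ≠ 2) (hn : 2 ≤ n)
    (h : e '' pCone p n = pCone p n) (k : Fin n) : e (coneAxis n) k.succ = 0 := by
  by_contra hz
  set z := e (coneAxis n) k.succ with hzdef
  -- The images of the two vertices over `i` have `k`-coordinates summing to `2 z`, so one of them
  -- lies on the vertex ray over `k` with the sign of `z`. Two distinct `i` then share a ray,
  -- against injectivity.
  have key : ∀ i : Fin n, ∃ s b u : ℝ, |s| = 1 ∧ 0 < b ∧ |u| = 1 ∧ 0 < u * z ∧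
      e (oneConeVertex i s) = b • oneConeVertex k u := by
    intro i
    obtain ⟨b, l, u, hb, hu, he⟩ := exists_map_vertex_eq hp hp2 h i (s := 1) abs_one
    obtain ⟨b', l', u', hb', hu', he'⟩ := exists_map_vertex_eq hp hp2 h i (s := -1) (by simp)
    have hsum := congrFun (congrArg e (vertex_add_vertex i)) k.succ
    rw [map_add, map_smul, he, he'] at hsum
    simp only [Pi.add_apply, Pi.smul_apply, oneConeVertex_succ, smul_eq_mul, ← hzdef] at hsum
    have hpos : 0 < b * ((Pi.single l u : Fin n → ℝ) k * z) +
        b' * ((Pi.single l' u' : Fin n → ℝ) k * z) := by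
      have : 0 < z * z := mul_self_pos.2 hz
      calc 0 < 2 * z * z := by linarith
        _ = _ := by rw [← hsum]; ring
    have hcase : ∀ {c w : ℝ} {m : Fin n}, 0 < c → 0 < c * ((Pi.single m w : Fin n → ℝ) k * z) →
        m = k ∧ 0 < w * z := by
      intro c w m hc hpos
      have hpos' := pos_of_mul_pos_right hpos hc.le
      by_cases hm : k = m
      · subst hm; simpa using hpos'
      · simp [hm] at hpos'
    rcases lt_or_ge 0 (b * ((Pi.single l u : Fin n → ℝ) k * z)) with h1 | h1
    · obtain ⟨rfl, h2⟩ := hcase hb h1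
      exact ⟨1, b, u, abs_one, hb, hu, h2, he⟩
    · obtain ⟨rfl, h2⟩ := hcase hb' (by linarith)
      exact ⟨-1, b', u', by simp, hb', hu', h2, he'⟩
  obtain ⟨s, b, u, hs, hb, hu, hpos, he⟩ := key ⟨0, by omega⟩
  obtain ⟨s', b', u', -, hb', hu', hpos', he'⟩ := key ⟨1, by omega⟩
  have huu : u = u' := by
    rcases abs_eq_abs.1 (hu.trans hu'.symm) with h1 | h1
    · exact h1
    · rw [h1] at hpos; linarith
  subst huu
  simpa using eq_of_map_vertex_eq hs hb' he he'

theorem map_coneAxis_eq (hp : 1 < p) (hp2 : p ≠ 2) (hn : 2 ≤ n)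
    (h : e '' pCone p n = pCone p n) : ∃ α : ℝ, 0 < α ∧ e (coneAxis n) = α • coneAxis n := by
  have hp0 : 0 < p := by linarith
  refine ⟨e (coneAxis n) 0, apply_zero_pos_of_mem_pCone hp0
    (h ▸ Set.mem_image_of_mem e (coneAxis_mem_pCone hp0))
    ((map_ne_zero_iff e e.injective).2 coneAxis_ne_zero), ?_⟩
  ext j
  refine Fin.cases (by simp [coneAxis]) (fun j => ?_) j
  rw [map_coneAxis_succ_eq_zero hp hp2 hn h j]
  simp [coneAxis]

theorem exists_map_single_eq (hp : 1 < p) (hp2 : p ≠ 2) (h : e '' pCone p n = pCone p n) {α : ℝ}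
    (hα : e (coneAxis n) = α • coneAxis n) (i : Fin n) :
    ∃ (k : Fin n) (s : ℝ), |s| = 1 ∧
      e (Pi.single i.succ 1) = α • (Pi.single k.succ s : Fin (n + 1) → ℝ) := by
  obtain ⟨b, k, u, hb, hu, he⟩ := exists_map_vertex_eq hp hp2 h i (s := 1) abs_one
  obtain ⟨b', l, u', hb', hu', he'⟩ := exists_map_vertex_eq hp hp2 h i (s := -1) (by simp)
  have hsum := congrArg e (vertex_add_vertex i)
  rw [map_add, map_smul, he, he', hα] at hsum
  have hk := congrFun hsum k.succ
  have h0 := congrFun hsum 0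
  simp [coneAxis] at hk h0
  -- The tails of the two images must cancel, so their scale factors agree; coordinate `0` then
  -- identifies them with `α`.
  have hbb : b = b' := by
    by_cases hkl : k = l
    · subst hkl
      have h1 : b * u = -(b' * u') := by rw [Pi.single_eq_same] at hk; linarith
      have h2 := congrArg abs h1
      rwa [abs_neg, abs_mul, abs_mul, hu, hu', mul_one, mul_one, abs_of_pos hb,
        abs_of_pos hb'] at h2
    · have h1 : b * u = 0 := by simpa [hkl] using hk
      rcases mul_eq_zero.1 h1 with h2 | h2
      · exact absurd h2 hb.ne'
      · simp [h2] at hu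
  have hbα : b = α := by linarith
  refine ⟨k, u, hu, ?_⟩
  have hv : ∀ (i : Fin n) (s : ℝ),
      (Pi.single i.succ s : Fin (n + 1) → ℝ) = oneConeVertex i s - coneAxis n := by
    intro i s
    ext j
    refine Fin.cases (by simp [coneAxis]) (fun j => ?_) j
    by_cases hj : j = i
    · subst hj; simp [coneAxis]
    · simp [coneAxis, hj]
  rw [hv, hv, map_sub, he, hα, hbα, smul_sub]

end ConeMaps

/-! ### Signed permutations and the block form -/

section Matrices

variable {n : ℕ} {p : ℝ}

theorem oneBlock_mulVec_zero (D : Matrix (Fin n) (Fin n) ℝ) (x : Fin (n + 1) → ℝ) :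
    (oneBlock D).mulVec x 0 = x 0 := by
  simp [oneBlock, Matrix.mulVec, dotProduct, Fin.sum_univ_succ]

theorem oneBlock_mulVec_succ (D : Matrix (Fin n) (Fin n) ℝ) (x : Fin (n + 1) → ℝ) (i : Fin n) :
    (oneBlock D).mulVec x i.succ = D.mulVec (Fin.tail x) i := by
  simp [oneBlock, Matrix.mulVec, dotProduct, Fin.sum_univ_succ, Fin.tail]

theorem IsSignedPermMatrix.pNorm_mulVec {D : Matrix (Fin n) (Fin n) ℝ} (hD : IsSignedPermMatrix D)
    (x : Fin n → ℝ) : pNorm p (D.mulVec x) = pNorm p x := by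
  obtain ⟨σ, ε, hε, rfl⟩ := hD
  have h : ∀ i, |(Matrix.diagonal ε * σ.permMatrix ℝ).mulVec x i| = |x (σ i)| := by
    intro i
    rw [← Matrix.mulVec_mulVec, Matrix.mulVec_diagonal, Matrix.permMatrix_mulVec, abs_mul]
    rcases hε i with h | h <;> simp [h]
  unfold pNorm
  simp only [h]
  rw [Equiv.sum_comp σ fun i => |x i| ^ p]

theorem smul_oneBlock_mulVec_mem_pCone_iff (hp : 0 < p) {D : Matrix (Fin n) (Fin n) ℝ}
    (hD : IsSignedPermMatrix D) {α : ℝ} (hα : 0 < α) (x : Fin (n + 1) → ℝ) :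
    (α • oneBlock D).mulVec x ∈ pCone p n ↔ x ∈ pCone p n := by
  have h : Fin.tail ((α • oneBlock D).mulVec x) = α • D.mulVec (Fin.tail x) := by
    ext i; simp [Fin.tail, Matrix.smul_mulVec, oneBlock_mulVec_succ]
  rw [mem_pCone, mem_pCone, h, pNorm_smul hp, hD.pNorm_mulVec, Matrix.smul_mulVec, Pi.smul_apply,
    oneBlock_mulVec_zero, smul_eq_mul, abs_of_pos hα, mul_le_mul_iff_right₀ hα]

theorem eq_smul_oneBlock_of_image_pCone (hp : 1 < p) (hp2 : p ≠ 2) (hn : 2 ≤ n)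
    {A : Matrix (Fin (n + 1)) (Fin (n + 1)) ℝ} (h : A.mulVec '' pCone p n = pCone p n) :
    ∃ (α : ℝ) (D : Matrix (Fin n) (Fin n) ℝ),
      0 < α ∧ IsSignedPermMatrix D ∧ A = α • oneBlock D := by
  obtain ⟨e, he⟩ := exists_linearEquiv_of_image_pCone (f := A.mulVecLin) (q := p) (by linarith) h
  have hK : e '' pCone p n = pCone p n := by
    nth_rw 2 [← h]; exact Set.image_congr fun x _ => he x
  obtain ⟨α, hα, hax⟩ := map_coneAxis_eq hp hp2 hn hK
  choose k s hs hks using exists_map_single_eq hp hp2 hK hax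
  -- If `k i = k j`, cross-multiplying by the signs gives two independent vectors the same image.
  have hinj : Function.Injective k := by
    intro i j hij
    by_contra hne
    have h1 : e (s j • Pi.single i.succ 1) = e (s i • Pi.single j.succ 1) := by
      rw [map_smul, map_smul, hks, hks, hij, smul_comm _ α, smul_comm _ α]
      simp [← Pi.single_smul, mul_comm]
    have h2 := congrFun (e.injective h1) i.succ
    have h3 : s j = 0 := by simpa [hne] using h2
    simpa [h3] using hs j
  set σ : Equiv.Perm (Fin n) := Equiv.ofBijective k (Finite.injective_iff_bijective.1 hinj)
  have hσ : ∀ i, σ i = k i := fun _ => rfl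
  -- Column `j` of the tail block has its entry in row `k j`; read by rows, row `i` has it in column
  -- `σ.symm i`, hence the inverse permutation.
  refine ⟨α, Matrix.diagonal (fun i => s (σ.symm i)) * Equiv.Perm.permMatrix ℝ σ.symm, hα,
    ⟨σ.symm, _, fun i => eq_or_eq_neg_of_abs_eq (hs _), rfl⟩, ?_⟩
  have hcol : ∀ j i, A i j = e (Pi.single j 1) i := fun j i => by rw [he]; simp
  have hax' : e (Pi.single 0 1) = α • (Pi.single 0 1 : Fin (n + 1) → ℝ) := hax
  ext i j
  rw [hcol]
  refine Fin.cases ?_ (fun j => ?_) j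
  · rw [hax']
    refine Fin.cases (by simp [oneBlock]) (fun i => by simp [oneBlock]) i
  · rw [hks]
    refine Fin.cases (by simp [oneBlock]) (fun i => ?_) i
    by_cases hij : i = k j
    · have : σ.symm (k j) = j := by rw [← hσ, Equiv.symm_apply_apply]
      subst hij
      simp [oneBlock, Matrix.diagonal_mul, Equiv.Perm.permMatrix, PEquiv.toMatrix_apply, this]
    · have : σ.symm i ≠ j := fun h => hij (by rw [← hσ, ← h, Equiv.apply_symm_apply])
      simp [oneBlock, Matrix.diagonal_mul, Equiv.Perm.permMatrix, PEquiv.toMatrix_apply, this, hij]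

end Matrices

/-! ### Dual cones, self-duality and homogeneity -/

section Duality

variable {n : ℕ} {p q : ℝ}

theorem pNorm_eq_rpow (p : ℝ) (x : Fin n → ℝ) : pNorm p x = (∑ i, |x i| ^ p) ^ (1 / p) := rfl

/-- The dual of the `p`-cone with respect to the dot product is the cone of the conjugate
exponent. -/
theorem forall_dotProduct_nonneg_iff (hpq : p.HolderConjugate q) (z : Fin (n + 1) → ℝ) :
    (∀ x ∈ pCone p n, 0 ≤ x ⬝ᵥ z) ↔ z ∈ pCone q n := by
  have hdot : ∀ x : Fin (n + 1) → ℝ, x ⬝ᵥ z = x 0 * z 0 + ∑ i, Fin.tail x i * Fin.tail z i :=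
    fun x => by simp [dotProduct, Fin.sum_univ_succ, Fin.tail]
  constructor
  · intro h
    rw [mem_pCone]
    set S : ℝ := ∑ i, |Fin.tail z i| ^ q with hS
    have hS0 : 0 ≤ S := Finset.sum_nonneg fun _ _ => Real.rpow_nonneg (abs_nonneg _) _
    -- The equality case of Hölder: since `(q - 1) p = q`, testing against `(‖u‖ₚ, u)` gives `S ≤ S
    -- ^ (1 / p) * z 0`, which is the claim once divided by `S ^ (1 / p)`. The case `S = 0` needs
    -- the axis instead.
    set u : Fin n → ℝ := fun i => -(SignType.sign (Fin.tail z i) * |Fin.tail z i| ^ (q - 1))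
    have hq1 : 0 < q - 1 := sub_pos.2 hpq.symm.lt
    have hu1 : ∀ i, |u i| = |Fin.tail z i| ^ (q - 1) := by
      intro i
      have hnn := Real.rpow_nonneg (abs_nonneg (Fin.tail z i)) (q - 1)
      by_cases h0 : Fin.tail z i = 0
      · simp [u, h0, Real.zero_rpow hq1.ne']
      · rcases lt_or_gt_of_ne h0 with h1 | h1
        · simp [u, sign_neg h1, abs_of_nonneg hnn]
        · simp [u, sign_pos h1, abs_of_nonneg hnn]
    have hu2 : ∀ i, u i * Fin.tail z i = -|Fin.tail z i| ^ q := by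
      intro i
      have e : |Fin.tail z i| ^ q = |Fin.tail z i| ^ (q - 1) * |Fin.tail z i| := by
        by_cases h0 : Fin.tail z i = 0
        · simp [h0, Real.zero_rpow hpq.symm.ne_zero]
        · rw [← Real.rpow_add_one (abs_pos.2 h0).ne', sub_add_cancel]
      rw [e]
      have e2 := sign_mul_self (Fin.tail z i)
      simp only [u]
      rw [← e2]
      ring
    have hu3 : ∑ i, |u i| ^ p = S := by
      refine Finset.sum_congr rfl fun i _ => ?_
      rw [hu1, ← Real.rpow_mul (abs_nonneg _), hpq.symm.sub_one_mul_conj]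
    have h1 := h (Fin.cons (pNorm p u) u) (by rw [mem_pCone, Fin.tail_cons, Fin.cons_zero])
    rw [hdot, Fin.cons_zero, Fin.tail_cons, pNorm_eq_rpow p, hu3] at h1
    simp only [hu2, Finset.sum_neg_distrib, ← hS] at h1
    rw [pNorm_eq_rpow, ← hS]
    rcases hS0.eq_or_lt with h0 | hpos
    · have h2 := h (coneAxis n) (coneAxis_mem_pCone hpq.pos)
      rw [hdot, tail_coneAxis] at h2
      rw [← h0, Real.zero_rpow (one_div_ne_zero hpq.symm.ne_zero)]
      simpa [coneAxis] using h2
    · have h3 : 0 < S ^ (1 / p) := Real.rpow_pos_of_pos hpos _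
      refine le_of_mul_le_mul_left ?_ h3
      rw [← Real.rpow_add hpos]
      have : 1 / p + 1 / q = 1 := by simpa using hpq.inv_add_inv_eq_one
      rw [this, Real.rpow_one]
      linarith
  · intro hz x hx
    rw [hdot]
    have h1 := Real.inner_le_Lp_mul_Lq Finset.univ (fun i => -Fin.tail x i) (Fin.tail z) hpq
    simp only [abs_neg, neg_mul, Finset.sum_neg_distrib] at h1
    rw [← pNorm_eq_rpow, ← pNorm_eq_rpow] at h1
    have h2 := mul_le_mul (mem_pCone.1 hx) (mem_pCone.1 hz) (pNorm_nonneg _ _)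
      ((pNorm_nonneg _ _).trans hx)
    linarith

/-- `Q` is the Gram matrix of the standard basis, injective by definiteness. -/
theorem exists_linearMap_inner_eq_dotProduct (c : InnerProductSpace.Core ℝ (Fin n → ℝ)) :
    ∃ Q : (Fin n → ℝ) →ₗ[ℝ] (Fin n → ℝ), Function.Injective Q ∧ ∀ x y, c.inner x y = x ⬝ᵥ Q y := by
  have hsymm : ∀ x y, c.inner x y = c.inner y x := fun x y => by
    simpa using c.conj_inner_symm y x
  have hadd : ∀ x y z, c.inner (x + y) z = c.inner x z + c.inner y z := c.add_left
  have hsmul : ∀ (r : ℝ) x y, c.inner (r • x) y = r * c.inner x y := fun r x y => by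
    simpa using c.smul_left x y r
  let Q : (Fin n → ℝ) →ₗ[ℝ] (Fin n → ℝ) :=
    { toFun := fun y i => c.inner y (fun j => if i = j then 1 else 0)
      map_add' := fun x y => funext fun i => hadd _ _ _
      map_smul' := fun r x => funext fun i => hsmul _ _ _ }
  have hQ : ∀ x y, c.inner x y = x ⬝ᵥ Q y := by
    intro x y
    let L : (Fin n → ℝ) →ₗ[ℝ] ℝ :=
      { toFun := fun x => c.inner x y
        map_add' := fun _ _ => hadd _ _ _
        map_smul' := fun _ _ => hsmul _ _ _ }
    have h := L.pi_apply_eq_sum_univ x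
    simp only [smul_eq_mul] at h
    refine h.trans (Finset.sum_congr rfl fun i _ => ?_)
    exact congrArg _ (hsymm _ _)
  refine ⟨Q, (injective_iff_map_eq_zero Q).2 fun y hy => ?_, hQ⟩
  exact c.definite y (by rw [hQ, hy, dotProduct_zero])

theorem not_isSelfDualCone_pCone (hp : 1 < p) (hp2 : p ≠ 2) (hn : 2 ≤ n) :
    ¬ IsSelfDualCone (pCone p n) := by
  rintro ⟨c, hc⟩
  obtain ⟨Q, hinj, hQ⟩ := exists_linearMap_inner_eq_dotProduct c
  have hpq : p.HolderConjugate (p / (p - 1)) := Real.HolderConjugate.conjExponent hp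
  set e := LinearEquiv.ofBijective Q ⟨hinj, LinearMap.injective_iff_surjective.1 hinj⟩
  -- The dual cone for `c` is the preimage under `Q` of the dot-product dual.
  have hmem : ∀ y, e y ∈ pCone (p / (p - 1)) n ↔ y ∈ pCone p n := by
    intro y
    rw [← forall_dotProduct_nonneg_iff hpq]
    nth_rw 2 [← hc]
    refine forall₂_congr fun x _ => ?_
    rw [hQ]
    rfl
  have himg : e '' pCone p n = pCone (p / (p - 1)) n := by
    ext z
    constructor
    · rintro ⟨y, hy, rfl⟩
      exact (hmem y).2 hy
    · intro hz
      exact ⟨e.symm z, (hmem _).1 (by rwa [e.apply_symm_apply]), e.apply_symm_apply z⟩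
  have h := eq_of_image_pCone hp hpq.symm.lt hn himg
  rw [eq_div_iff (by linarith)] at h
  have : p * (p - 2) = 0 := by linear_combination h
  rcases mul_eq_zero.1 this with h1 | h1
  · linarith
  · exact hp2 (by linarith)

theorem mem_intrinsicInterior_pCone (hp : 0 < p) {x : Fin (n + 1) → ℝ}
    (hx : pNorm p (Fin.tail x) < x 0) : x ∈ intrinsicInterior ℝ (pCone p n) := by
  refine interior_subset_intrinsicInterior (mem_interior.2
    ⟨{x | pNorm p (Fin.tail x) < x 0}, fun y hy => mem_pCone.2 (le_of_lt hy), ?_, hx⟩)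
  exact isOpen_lt ((continuous_pNorm hp).comp (by unfold Fin.tail; fun_prop)) (by fun_prop)

theorem not_isHomogeneousCone_pCone (hp : 1 < p) (hp2 : p ≠ 2) (hn : 2 ≤ n) :
    ¬ IsHomogeneousCone (pCone p n) := by
  intro hhom
  have hp0 : 0 < p := by linarith
  let i : Fin n := ⟨0, by omega⟩
  obtain ⟨f, hf, hK⟩ := hhom (coneAxis n)
    (mem_intrinsicInterior_pCone hp0 (by rw [tail_coneAxis, pNorm_zero hp0]; simp [coneAxis]))
    -- An interior point off the axis, unreachable from it because automorphisms preserve the axis.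
    (Fin.cons 2 (Pi.single i 1))
    (mem_intrinsicInterior_pCone hp0 (by rw [Fin.tail_cons, pNorm_single hp0]; simp))
  obtain ⟨e, he⟩ := exists_linearEquiv_of_image_pCone hp0 hK
  have hK' : e '' pCone p n = pCone p n := by
    nth_rw 2 [← hK]; exact Set.image_congr fun x _ => he x
  have h := map_coneAxis_succ_eq_zero hp hp2 hn hK' i
  rw [he, hf, Fin.cons_succ, Pi.single_eq_same] at h
  exact one_ne_zero h

end Duality

theorem mainTheorem9 (p : ℝ) (hp : 1 < p) (n : ℕ) (hn : 2 ≤ n) :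
    (∀ p' : ℝ, p < p' →
      ¬ ∃ A : Matrix (Fin (n + 1)) (Fin (n + 1)) ℝ, A.mulVec '' pCone p n = pCone p' n) ∧
    (p ≠ 2 → ∀ A : Matrix (Fin (n + 1)) (Fin (n + 1)) ℝ, A.mulVec '' pCone p n = pCone p n →
      A.mulVec '' pCone 1 n = pCone 1 n ∧
      ∃ (α : ℝ) (D : Matrix (Fin n) (Fin n) ℝ),
        0 < α ∧ IsSignedPermMatrix D ∧ A = α • oneBlock D) ∧
    (p ≠ 2 → ¬ IsSelfDualCone (pCone p n) ∧ ¬ IsHomogeneousCone (pCone p n)) := by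
  refine ⟨?_, fun hp2 A hA => ?_, fun hp2 =>
    ⟨not_isSelfDualCone_pCone hp hp2 hn, not_isHomogeneousCone_pCone hp hp2 hn⟩⟩
  · rintro p' hp' ⟨A, hA⟩
    have hp'1 : 1 < p' := hp.trans hp'
    obtain ⟨e, he⟩ := exists_linearEquiv_of_image_pCone (f := A.mulVecLin) (q := p')
      (by linarith) hA
    exact hp'.ne (eq_of_image_pCone (e := e) hp hp'1 hn
      (by rw [← hA]; exact Set.image_congr fun x _ => he x))
  · obtain ⟨α, D, hα, hD, hAD⟩ := eq_smul_oneBlock_of_image_pCone hp hp2 hn hA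
    refine ⟨?_, α, D, hα, hD, hAD⟩
    -- Contact order is not used for the `1`-cone: the block form gives invariance of membership,
    -- and surjectivity turns this into equality of sets.
    have hsurj : Function.Surjective A.mulVecLin := surjective_of_pCone_subset_range (q := p)
      (by linarith) (hA ▸ Set.image_subset_range A.mulVecLin _)
    have hmem : ∀ x, A.mulVec x ∈ pCone 1 n ↔ x ∈ pCone 1 n := fun x => by
      rw [hAD]; exact smul_oneBlock_mulVec_mem_pCone_iff one_pos hD hα x
    ext y
    constructor
    · rintro ⟨x, hx, rfl⟩
      exact (hmem x).2 hx
    · intro hy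
      obtain ⟨x, rfl⟩ := hsurj y
      exact ⟨x, (hmem x).1 hy, rfl⟩
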